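/- Let $n\ge 1$, $\sigma_1\ge\sigma_2>0$, $L>0$, $r>0$. Write $x=(x_1,\tilde x)\in\mathbb{R}\times\mathbb{R}^{n-1}=\mathbb{R}^n$, with the Euclidean norm, and put $p_1=(-r,\mathbf 0)$, $p_2=(r,\mathbf 0)$. For $i\in\{1,2\}$ let $\mathcal B_i=\{x:\|x-p_i\|<L/\sigma_i\}$ and, with $\angle(u,v)=\arccos\frac{\langle u,v\rangle}{\|u\|\|v\|}$, let $$\tilde\phi_i(x)=\arccos\Big(\frac{\sigma_i}{L}\|x-p_i\|\Big)\ \ (x\in\overline{\mathcal B}_i),\qquad \alpha_i(x)=\angle(x-p_i,\,p_2-p_1)\ \ (x\ne p_i),\qquad \psi(x)=\pi-(\alpha_2(x)-\alpha_1(x)).$$ Let $D=(\overline{\mathcal B}_1\cap\overline{\mathcal B}_2)\setminus\{p_1,p_2\}$ be the common domain of $\tilde\phi_1,\tilde\phi_2,\psi$, let $\widetilde{\mathcal T}=\{x\in D:\tilde\phi_1(x)+\tilde\phi_2(x)>\psi(x)\}$, let $\mathcal X=\{x:\|x-p_i\|=L/\sigma_i,\ i=1,2\}$ if $\|p_2-p_1\|=L(\frac1{\sigma_1}+\frac1{\sigma_2})$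 and $\mathcal X=\emptyset$ otherwise, and put $$\mathcal M_\downarrow=\widetilde{\mathcal T}\cup\mathcal X .$$ Let $$\mathcal T=\Big\{x\in D:\ \frac{\|x\|^2-r^2}{\|x-p_1\|^2\|x-p_2\|^2}+\frac{\sigma_1\sigma_2}{L^2}=\sqrt{\frac1{\|x-p_1\|^2}-\frac{\sigma_1^2}{L^2}}\sqrt{\frac1{\|x-p_2\|^2}-\frac{\sigma_2^2}{L^2}}\Big\}.$$ With $\gamma_i=L^2/\sigma_i^2$ and $\beta=\sigma_2/\sigma_1$ let $$\lambda_1=\frac{1+\beta}{1+2\beta}\cdot\frac{\gamma_1}{2r}-\frac{r}{1+2\beta},\qquad \lambda_2=-\frac{1+\beta}{2+\beta}\cdot\frac{\gamma_2}{2r}+\frac{\beta r}{2+\beta},$$ $$\nu_1=\frac{r}{2(1+2\beta)}\sqrt{-\Big(\frac{\gamma_1}{r^2}-4\Big)\Big((1+\beta)^2\frac{\gamma_1}{r^2}-4\beta^2\Big)},\qquad \nu_2=\frac{r}{2(2+\beta)}\sqrt{-\Big(\frac{\gamma_2}{r^2}-4\Big)\Big((1+\beta)^2\frac{\gamma_2}{r^2}-4\Big)},$$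 and for $i\in\{1,2\}$ let $\mathcal H_i^+=\{x:x_1\ge\lambda_i\}$, $\mathcal H_i^-=\{x:x_1\le\lambda_i\}$, $\mathcal C_i=\{x:x_1=\lambda_i,\ \|\tilde x\|=\nu_i\}$ (the $\mathcal C_i$ are only used below for values of $r$ at which the radicand in $\nu_i$ is nonnegative). Let $\partial$, $^\circ$ and $^c$ denote boundary, interior and complement in $\mathbb R^n$, and $\sqcup$ a union of pairwise disjoint sets (the disjointness being part of the claim). Then: (i) If $0<r\le\frac{L}{2\sigma_1}$, then $\mathcal M_\downarrow$ is open, $\partial\mathcal M_\downarrow=\mathcal T\sqcup\{p_1,p_2\}$ and $(\mathcal M_\downarrow)^\circ=\widetilde{\mathcal T}$. (ii) If $\frac{L}{2\sigma_1}<r\le\frac{L}{2\sigma_2}$, then $(\mathcal M_\downarrow\cup\mathcal C_1)\cap\mathcal H_1^+$ is closed, $\mathcal M_\downarrow\cap(\mathcal H_1^+)^c$ is open, $$\partial\mathcal M_\downarrow=[\partial\mathcal B_1\cap(\mathcal H_1^-)^c]\sqcup\mathcal T\sqcup\{p_1\},\qquad (\mathcal M_\downarrow)^\circ=[\mathcal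 B_1\cap(\mathcal H_1^-)^c]\sqcup[\widetilde{\mathcal T}\cap\mathcal H_1^-].$$ (iii) If $\frac{L}{2\sigma_2}<r<\frac L2(\frac1{\sigma_1}+\frac1{\sigma_2})$, then $(\mathcal M_\downarrow\cup\mathcal C_1)\cap\mathcal H_1^+$ and $(\mathcal M_\downarrow\cup\mathcal C_2)\cap\mathcal H_2^-$ are closed, $\mathcal M_\downarrow\cap(\mathcal H_1^+\cup\mathcal H_2^-)^c$ is open, $$\partial\mathcal M_\downarrow=[\partial\mathcal B_1\cap(\mathcal H_1^-)^c]\sqcup[\partial\mathcal B_2\cap(\mathcal H_2^+)^c]\sqcup\mathcal T,$$ $$(\mathcal M_\downarrow)^\circ=[\mathcal B_1\cap(\mathcal H_1^-)^c]\sqcup[\mathcal B_2\cap(\mathcal H_2^+)^c]\sqcup[\widetilde{\mathcal T}\cap(\mathcal H_1^-\cap\mathcal H_2^+)].$$ (iv) If $r=\frac L2(\frac1{\sigma_1}+\frac1{\sigma_2})$, then $\mathcal M_\downarrow=\big\{\big(\frac L2(\frac1{\sigma_1}-\frac1{\sigma_2}),\mathbf 0\big)\big\}$. (v) If $r>\frac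 L2(\frac1{\sigma_1}+\frac1{\sigma_2})$, then $\mathcal M_\downarrow=\emptyset$. -/

import Mathlib

open Metric Real

namespace MinRegion

noncomputable section

/-- The Euclidean space `ℝⁿ` with `n = m + 1 ≥ 1`; the first coordinate of `x` is `x 0`. -/
abbrev E (m : ℕ) : Type := EuclideanSpace ℝ (Fin (m + 1))

/-- The vector `x̃ = (x₂, …, xₙ) ∈ ℝⁿ⁻¹` of all coordinates of `x` but the first. -/
def tail {m : ℕ} (x : E m) : EuclideanSpace ℝ (Fin m) :=
  WithLp.toLp 2 fun i => x i.succ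

/-- The point `(t, 0, …, 0) ∈ ℝⁿ`. -/
def axisPoint (m : ℕ) (t : ℝ) : E m := EuclideanSpace.single 0 t

/-- `φ̃(x) = arccos ((σ / L) ‖x - p‖)`, used on the closed ball of radius `L / σ` around `p`. -/
def phiTilde {m : ℕ} (p : E m) (σ L : ℝ) (x : E m) : ℝ :=
  arccos (σ / L * ‖x - p‖)

/-- `ψ(x) = π - (α₂(x) - α₁(x))`, where `αᵢ(x)` is the (unoriented) angle between `x - xᵢ` and
`x₂ - x₁`; used off `{x₁, x₂}`. -/
def psi {m : ℕ} (x₁ x₂ x : E m) : ℝ :=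
  π - (InnerProductGeometry.angle (x - x₂) (x₂ - x₁)
    - InnerProductGeometry.angle (x - x₁) (x₂ - x₁))

/-- The set on which `φ̃₁`, `φ̃₂` and `ψ` are all defined. -/
def angleDomain {m : ℕ} (x₁ x₂ : E m) (σ₁ σ₂ L : ℝ) : Set (E m) :=
  (closedBall x₁ (L / σ₁) ∩ closedBall x₂ (L / σ₂)) \ {x₁, x₂}

/-- The set `{x : φ̃₁(x) + φ̃₂(x) > ψ(x)}`. -/
def Ttilde {m : ℕ} (x₁ x₂ : E m) (σ₁ σ₂ L : ℝ) : Set (E m) :=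
  {x | x ∈ angleDomain x₁ x₂ σ₁ σ₂ L ∧
    phiTilde x₁ σ₁ L x + phiTilde x₂ σ₂ L x > psi x₁ x₂ x}

/-- The set `𝒳`: empty unless `‖x₂ - x₁‖ = L (1 / σ₁ + 1 / σ₂)`. -/
def touchingSet {m : ℕ} (x₁ x₂ : E m) (σ₁ σ₂ L : ℝ) : Set (E m) :=
  {x | ‖x₂ - x₁‖ = L * (1 / σ₁ + 1 / σ₂) ∧ ‖x - x₁‖ = L / σ₁ ∧ ‖x - x₂‖ = L / σ₂}

/-- The inner approximation `M↓ = {x : φ̃₁(x) + φ̃₂(x) > ψ(x)} ∪ 𝒳`. -/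
def innerApprox {m : ℕ} (x₁ x₂ : E m) (σ₁ σ₂ L : ℝ) : Set (E m) :=
  Ttilde x₁ x₂ σ₁ σ₂ L ∪ touchingSet x₁ x₂ σ₁ σ₂ L

/-- The half-space `{x : x₁ ≥ c}`. -/
def halfGE (m : ℕ) (c : ℝ) : Set (E m) := {x | c ≤ x 0}

/-- The half-space `{x : x₁ ≤ c}`. -/
def halfLE (m : ℕ) (c : ℝ) : Set (E m) := {x | x 0 ≤ c}

/-- The set `{x : x₁ = c, ‖x̃‖ = ν}`. -/
def circ (m : ℕ) (c ν : ℝ) : Set (E m) := {x | x 0 = c ∧ ‖tail x‖ = ν}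

/-- The numbers on which all the sets below depend; their positivity is assumed separately. -/
structure Params where
  σ₁ : ℝ
  σ₂ : ℝ
  L : ℝ
  r : ℝ

namespace Params

/-- `γ₁ = L² / σ₁²`. -/
def γ₁ (P : Params) : ℝ := P.L ^ 2 / P.σ₁ ^ 2

/-- `γ₂ = L² / σ₂²`. -/
def γ₂ (P : Params) : ℝ := P.L ^ 2 / P.σ₂ ^ 2

/-- `β = σ₂ / σ₁`. -/
def β (P : Params) : ℝ := P.σ₂ / P.σ₁

/-- The number `λ₁`. -/
def lam₁ (P : Params) : ℝ :=
  (1 + P.β) / (1 + 2 * P.β) * (P.γ₁ / (2 * P.r)) - P.r / (1 + 2 * P.β)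

/-- The number `λ₂`. -/
def lam₂ (P : Params) : ℝ :=
  -((1 + P.β) / (2 + P.β)) * (P.γ₂ / (2 * P.r)) + P.β * P.r / (2 + P.β)

/-- The number `ν₁`. -/
def nu₁ (P : Params) : ℝ :=
  P.r / (2 * (1 + 2 * P.β)) *
    √(-(P.γ₁ / P.r ^ 2 - 4) * ((1 + P.β) ^ 2 * (P.γ₁ / P.r ^ 2) - 4 * P.β ^ 2))

/-- The number `ν₂`. -/
def nu₂ (P : Params) : ℝ :=
  P.r / (2 * (2 + P.β)) *
    √(-(P.γ₂ / P.r ^ 2 - 4) * ((1 + P.β) ^ 2 * (P.γ₂ / P.r ^ 2) - 4))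

/-- The point `x₁ = (-r, 0, …, 0)`. -/
def x₁ (P : Params) (m : ℕ) : E m := axisPoint m (-P.r)

/-- The point `x₂ = (r, 0, …, 0)`. -/
def x₂ (P : Params) (m : ℕ) : E m := axisPoint m P.r

/-- The open ball `B₁` of radius `L / σ₁` around `x₁`. -/
def B₁ (P : Params) (m : ℕ) : Set (E m) := ball (P.x₁ m) (P.L / P.σ₁)

/-- The open ball `B₂` of radius `L / σ₂` around `x₂`. -/
def B₂ (P : Params) (m : ℕ) : Set (E m) := ball (P.x₂ m) (P.L / P.σ₂)

/-- The inner approximation `M↓` for the points `x₁ = (-r, 0)` and `x₂ = (r, 0)`. -/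
def M (P : Params) (m : ℕ) : Set (E m) := innerApprox (P.x₁ m) (P.x₂ m) P.σ₁ P.σ₂ P.L

/-- The set `{x : φ̃₁(x) + φ̃₂(x) > ψ(x)}` for the points `x₁ = (-r, 0)` and `x₂ = (r, 0)`. -/
def T' (P : Params) (m : ℕ) : Set (E m) := Ttilde (P.x₁ m) (P.x₂ m) P.σ₁ P.σ₂ P.L

/-- The set `𝒯`. The membership in `angleDomain` says exactly that the denominators are nonzero and
the radicands are nonnegative. -/
def T (P : Params) (m : ℕ) : Set (E m) :=
  {x | x ∈ angleDomain (P.x₁ m) (P.x₂ m) P.σ₁ P.σ₂ P.L ∧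
    (‖x‖ ^ 2 - P.r ^ 2) / (‖x - P.x₁ m‖ ^ 2 * ‖x - P.x₂ m‖ ^ 2) + P.σ₁ * P.σ₂ / P.L ^ 2
      = √(1 / ‖x - P.x₁ m‖ ^ 2 - P.σ₁ ^ 2 / P.L ^ 2)
        * √(1 / ‖x - P.x₂ m‖ ^ 2 - P.σ₂ ^ 2 / P.L ^ 2)}

/-- The half-space `H₁⁺`. -/
def H₁p (P : Params) (m : ℕ) : Set (E m) := halfGE m P.lam₁

/-- The half-space `H₁⁻`. -/
def H₁m (P : Params) (m : ℕ) : Set (E m) := halfLE m P.lam₁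

/-- The half-space `H₂⁺`. -/
def H₂p (P : Params) (m : ℕ) : Set (E m) := halfGE m P.lam₂

/-- The half-space `H₂⁻`. -/
def H₂m (P : Params) (m : ℕ) : Set (E m) := halfLE m P.lam₂

/-- The set `C₁ = {x : x₁ = λ₁, ‖x̃‖ = ν₁}`. -/
def C₁ (P : Params) (m : ℕ) : Set (E m) := circ m P.lam₁ P.nu₁

/-- The set `C₂ = {x : x₁ = λ₂, ‖x̃‖ = ν₂}`. -/
def C₂ (P : Params) (m : ℕ) : Set (E m) := circ m P.lam₂ P.nu₂

end Params

end

end MinRegion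

namespace MinRegion

/-! Write `R₁`, `R₂` for the radii and `a`, `b` for the distances from `x` to the centres. The angle
sum of the triangle on `x` and the centres turns `ψ` into `π` minus the angle at `x`. Taking cosines
and multiplying by `ab` turns `φ̃₁ + φ̃₂ > ψ` into `0 < gap` (`psi_lt_iff`), where `gap` is
continuous everywhere and vanishes at both centres. Except when the balls touch, `M↓` is therefore
`{a ≤ R₁, b ≤ R₂, 0 < gap}`.

Its interior has all three inequalities strict. For overlapping balls its closure has `0 ≤ gap`
(`mem_closure_region_iff`): off the axis, shrinking both distances by a common factor makes a zero
gap positive; on the axis, the gap vanishes only at the centres, which are approached along the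
segment when they lie in both balls.

On the sphere `a = R₁` a square root vanishes and the gap is affine in `b ^ 2`. As `a ^ 2 - b ^ 2 =
4 r x₁`, its sign there is that of `x₁ - λ₁`, and the closed ball beyond that plane lies in `M↓` up
to the rim (`cap₁`; symmetrically `cap₂`). The regimes of `r` decide which of these caps are
nondegenerate; the set identities are then case distinctions. -/

/-- `φ̃₁ + φ̃₂ > ψ` is `0 < gap`, in terms of the distances `a`, `b` to the two centres. -/
noncomputable def gap (R₁ R₂ r a b : ℝ) : ℝ :=
  a * b * (√(1 - (a / R₁) ^ 2) * √(1 - (b / R₂) ^ 2)) - (a ^ 2 + b ^ 2 - 4 * r ^ 2) / 2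
    - a ^ 2 * b ^ 2 / (R₁ * R₂)

/-- On the sphere `a = R₁`, the gap is positive exactly for `b ^ 2 < capBound R₁ R₂ r`. -/
noncomputable def capBound (R₁ R₂ r : ℝ) : ℝ := (4 * r ^ 2 - R₁ ^ 2) * R₂ / (R₂ + 2 * R₁)

/-! ### The gap as a function of two distances -/

section RealInequalities

variable {R₁ R₂ r a b : ℝ}

theorem gap_comm (R₁ R₂ r a b : ℝ) : gap R₁ R₂ r a b = gap R₂ R₁ r b a := by
  unfold gap; ring

theorem capBound_mul (h₁ : 0 < R₁) (h₂ : 0 < R₂) :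
    capBound R₁ R₂ r * (1 + 2 * (R₁ / R₂)) = 4 * r ^ 2 - R₁ ^ 2 := by
  unfold capBound; field_simp

theorem gap_of_eq_left (h₁ : 0 < R₁) (h₂ : 0 < R₂) :
    gap R₁ R₂ r R₁ b = (1 + 2 * (R₁ / R₂)) / 2 * (capBound R₁ R₂ r - b ^ 2) := by
  have h := capBound_mul (r := r) h₁ h₂
  have e : (1 + 2 * (R₁ / R₂)) / 2 * (capBound R₁ R₂ r - b ^ 2)
      = (4 * r ^ 2 - R₁ ^ 2) / 2 - (1 + 2 * (R₁ / R₂)) / 2 * b ^ 2 := by rw [← h]; ring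
  rw [e, gap, div_self h₁.ne']
  norm_num
  field_simp
  ring

theorem gap_left_pos_iff (h₁ : 0 < R₁) (h₂ : 0 < R₂) :
    0 < gap R₁ R₂ r R₁ b ↔ b ^ 2 < capBound R₁ R₂ r := by
  rw [gap_of_eq_left h₁ h₂, mul_pos_iff_of_pos_left (by positivity), sub_pos]

theorem gap_left_nonneg_iff (h₁ : 0 < R₁) (h₂ : 0 < R₂) :
    0 ≤ gap R₁ R₂ r R₁ b ↔ b ^ 2 ≤ capBound R₁ R₂ r := by
  rw [gap_of_eq_left h₁ h₂, mul_nonneg_iff_of_pos_left (by positivity), sub_nonneg]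

/-- `4 r² - R₁² < (R₁ + R₂)² - R₁² = R₂ (R₂ + 2 R₁)`. -/
theorem capBound_lt (h₁ : 0 < R₁) (h₂ : 0 < R₂) (hr : 0 < r) (hd : 2 * r < R₁ + R₂) :
    capBound R₁ R₂ r < R₂ ^ 2 := by
  rw [capBound, div_lt_iff₀ (by positivity)]
  have : 4 * r ^ 2 < (R₁ + R₂) ^ 2 := by nlinarith
  nlinarith

theorem capBound_nonpos (h₁ : 0 < R₁) (h₂ : 0 < R₂) (hr : 0 < r) (hd : 2 * r ≤ R₁) :
    capBound R₁ R₂ r ≤ 0 := by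
  rw [capBound]
  apply div_nonpos_of_nonpos_of_nonneg _ (by positivity)
  apply mul_nonpos_of_nonpos_of_nonneg _ h₂.le
  nlinarith

theorem lt_of_mem_cap (h₁ : 0 < R₁) (h₂ : 0 < R₂) (hr : 0 < r) (hd : 2 * r < R₁ + R₂)
    (ha : 0 ≤ a) (haR : a ≤ R₁) (h : R₁ ^ 2 - capBound R₁ R₂ r ≤ a ^ 2 - b ^ 2) : b < R₂ := by
  have := capBound_lt h₁ h₂ hr hd
  have : a ^ 2 ≤ R₁ ^ 2 := by gcongr
  exact lt_of_pow_lt_pow_left₀ 2 h₂.le (by linarith)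

/-- Dropping the nonnegative root term and replacing `a` by `R₁` only lowers the gap, and leaves its
value on the sphere `a = R₁`, which is positive for `b ^ 2 < capBound R₁ R₂ r`. -/
theorem gap_pos_of_mem_cap (h₁ : 0 < R₁) (h₂ : 0 < R₂) (ha : 0 ≤ a) (hb : 0 ≤ b) (haR : a ≤ R₁)
    (h : R₁ ^ 2 - capBound R₁ R₂ r ≤ a ^ 2 - b ^ 2)
    (hs : a < R₁ ∨ R₁ ^ 2 - capBound R₁ R₂ r < a ^ 2 - b ^ 2) : 0 < gap R₁ R₂ r a b := by
  have hA : a ^ 2 ≤ R₁ ^ 2 := by gcongr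
  have hB : b ^ 2 < capBound R₁ R₂ r := by
    rcases hs with hs | hs
    · have : a ^ 2 < R₁ ^ 2 := by gcongr
      linarith
    · linarith
  have e := capBound_mul (r := r) h₁ h₂
  have h3 : a ^ 2 * b ^ 2 / (R₁ * R₂) ≤ R₁ / R₂ * b ^ 2 := by
    rw [div_le_iff₀ (by positivity)]
    have : R₁ / R₂ * b ^ 2 * (R₁ * R₂) = R₁ ^ 2 * b ^ 2 := by field_simp
    rw [this]; gcongr
  have h4 : 0 ≤ a * b * (√(1 - (a / R₁) ^ 2) * √(1 - (b / R₂) ^ 2)) := by positivity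
  have h5 : b ^ 2 * (1 + 2 * (R₁ / R₂)) < capBound R₁ R₂ r * (1 + 2 * (R₁ / R₂)) := by
    gcongr
  unfold gap
  linarith

/-- Scaling both distances down increases the gap. -/
theorem gap_scale_pos (h₁ : 0 < R₁) (h₂ : 0 < R₂) (hr : 0 < r) (ha : 0 < a) (hb : 0 < b)
    (h : gap R₁ R₂ r a b = 0) {k : ℝ} (hk : 0 < k) (hk1 : k < 1) :
    0 < gap R₁ R₂ r (k * a) (k * b) := by
  have hk2 : k ^ 2 < 1 := by nlinarith
  have s : √(1 - (a / R₁) ^ 2) * √(1 - (b / R₂) ^ 2)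
      ≤ √(1 - (k * a / R₁) ^ 2) * √(1 - (k * b / R₂) ^ 2) := by
    gcongr
    · nlinarith
    · nlinarith
  have s' := mul_le_mul_of_nonneg_left s (show 0 ≤ a * b by positivity)
  unfold gap at h ⊢
  have hc : 0 < a ^ 2 * b ^ 2 / (R₁ * R₂) := by positivity
  set c := a ^ 2 * b ^ 2 / (R₁ * R₂) with hcd
  have e : (k * a) ^ 2 * (k * b) ^ 2 / (R₁ * R₂) = k ^ 2 * k ^ 2 * c := by rw [hcd]; ring
  have e2 : k * a * (k * b) * (√(1 - (k * a / R₁) ^ 2) * √(1 - (k * b / R₂) ^ 2))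
      = k ^ 2 * (a * b * (√(1 - (k * a / R₁) ^ 2) * √(1 - (k * b / R₂) ^ 2))) := by ring
  rw [e, e2]
  have h6 := mul_le_mul_of_nonneg_left s' (show 0 ≤ k ^ 2 by positivity)
  -- The scaled gap is at least `2 (1 - k²) r² + k² (1 - k²) c`.
  have h7 : 0 < k ^ 2 * (1 - k ^ 2) * c := by
    have : 0 < 1 - k ^ 2 := by linarith
    positivity
  have h8 : 0 < (1 - k ^ 2) * r ^ 2 := by
    have : 0 < 1 - k ^ 2 := by linarith
    positivity
  have h9 : k ^ 2 * (a * b * (√(1 - (a / R₁) ^ 2) * √(1 - (b / R₂) ^ 2)))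
      = k ^ 2 * ((a ^ 2 + b ^ 2 - 4 * r ^ 2) / 2 + c) := by
    congr 1; linarith
  nlinarith

/-- The gap is positive strictly between the two centres. -/
theorem gap_pos_of_add_eq (h₁ : 0 < R₁) (h₂ : 0 < R₂) (hd : 2 * r < R₁ + R₂) (ha : 0 < a)
    (hb : 0 < b) (haR : a ≤ R₁) (hbR : b ≤ R₂) (h : a + b = 2 * r) : 0 < gap R₁ R₂ r a b := by
  have e : (a ^ 2 + b ^ 2 - 4 * r ^ 2) / 2 = - (a * b) := by
    have : 4 * r ^ 2 = (a + b) ^ 2 := by rw [h]; ring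
    rw [this]; ring
  have h4 : 0 ≤ a * b * (√(1 - (a / R₁) ^ 2) * √(1 - (b / R₂) ^ 2)) := by positivity
  -- Equality cannot hold in both `a ≤ R₁` and `b ≤ R₂`, because `a + b < R₁ + R₂`.
  have h5 : a * b < R₁ * R₂ := by
    rcases haR.lt_or_eq with h' | h'
    · exact mul_lt_mul h' hbR hb h₁.le
    · exact mul_lt_mul' haR (by linarith) hb.le h₁
  have h6 : a ^ 2 * b ^ 2 / (R₁ * R₂) < a * b := by
    rw [div_lt_iff₀ (by positivity)]
    have : 0 < a * b := by positivity
    nlinarith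
  unfold gap
  linarith

/-- The gap is negative on the line through the centres, outside of the segment. -/
theorem gap_neg_of_sub_sq (h₁ : 0 < R₁) (h₂ : 0 < R₂) (ha : 0 < a) (hb : 0 < b)
    (h : (a - b) ^ 2 = 4 * r ^ 2) : gap R₁ R₂ r a b < 0 := by
  have s : √(1 - (a / R₁) ^ 2) * √(1 - (b / R₂) ^ 2) ≤ 1 := by
    apply mul_le_one₀ <;> first | positivity | (rw [sqrt_le_one]; nlinarith [sq_nonneg (a/R₁), sq_nonneg (b/R₂)])
  have s' := mul_le_mul_of_nonneg_left s (show 0 ≤ a * b by positivity)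
  have h6 : 0 < a ^ 2 * b ^ 2 / (R₁ * R₂) := by positivity
  unfold gap
  rw [← h]
  linarith

theorem gap_zero_left : gap R₁ R₂ r 0 (2 * r) = 0 := by
  unfold gap; ring

theorem gap_zero_right : gap R₁ R₂ r (2 * r) 0 = 0 := by
  unfold gap; ring

theorem continuous_gap : Continuous fun p : ℝ × ℝ => gap R₁ R₂ r p.1 p.2 := by
  unfold gap; fun_prop

end RealInequalities

/-! ### From angles to the gap -/

/-- Comparison of `arccos u + arccos v` with `π - arccos w`. -/
theorem pi_sub_arccos_lt_iff {u v w : ℝ} (hu : 0 ≤ u) (hu1 : u ≤ 1) (hv : 0 ≤ v) (hv1 : v ≤ 1)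
    (hw : -1 ≤ w) (hw1 : w ≤ 1) :
    π - arccos w < arccos u + arccos v ↔ w + u * v < √(1 - u ^ 2) * √(1 - v ^ 2) := by
  have h1 : arccos u ≤ π / 2 := arccos_le_pi_div_two.2 hu
  have h2 : arccos v ≤ π / 2 := arccos_le_pi_div_two.2 hv
  -- Since `u` and `v` are nonnegative, the sum of their arccosines stays in `[0, π]`, where cosine
  -- is strictly decreasing.
  rw [← strictAntiOn_cos.lt_iff_gt (a := arccos u + arccos v) (b := π - arccos w)
    ⟨add_nonneg (arccos_nonneg _) (arccos_nonneg _), by linarith⟩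
    ⟨by linarith [arccos_le_pi w], by linarith [arccos_nonneg w]⟩]
  rw [cos_pi_sub, cos_add, cos_arccos hw hw1, cos_arccos (by linarith) hu1,
    cos_arccos (by linarith) hv1, sin_arccos, sin_arccos]
  constructor <;> intro h <;> linarith

section Angles

variable {m : ℕ} {x₁ x₂ x : E m} {σ₁ σ₂ L : ℝ}

theorem psi_eq (h₁ : x ≠ x₁) :
    psi x₁ x₂ x = π - InnerProductGeometry.angle (x - x₁) (x - x₂) := by
  by_cases h : x₂ = x₁
  · subst h
    simp [psi, InnerProductGeometry.angle_self (sub_ne_zero.2 h₁)]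
  have := InnerProductGeometry.angle_add_angle_sub_add_angle_sub_eq_pi (x := x - x₁)
    (y := x₂ - x₁) (sub_ne_zero.2 h)
  rw [show x - x₁ - (x₂ - x₁) = x - x₂ by abel, show x₂ - x₁ - (x - x₁) = -(x - x₂) by abel,
    InnerProductGeometry.angle_neg_right, InnerProductGeometry.angle_comm (x₂ - x₁)] at this
  rw [psi]
  linarith

theorem inner_sub_sub (x₁ x₂ x : E m) :
    inner ℝ (x - x₁) (x - x₂) = (‖x - x₁‖ ^ 2 + ‖x - x₂‖ ^ 2 - ‖x₂ - x₁‖ ^ 2) / 2 := by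
  have := norm_sub_sq_real (x - x₁) (x - x₂)
  rw [show x - x₁ - (x - x₂) = x₂ - x₁ by abel] at this
  linarith

/-- By the law of cosines the angle at `x` has cosine `(a² + b² - 4r²) / (2ab)`; multiplying the
cosine inequality by `ab` gives the gap. -/
theorem psi_lt_iff (hσ₁ : 0 < σ₁) (hσ₂ : 0 < σ₂) (hL : 0 < L)
    (hx : x ∈ angleDomain x₁ x₂ σ₁ σ₂ L) :
    psi x₁ x₂ x < phiTilde x₁ σ₁ L x + phiTilde x₂ σ₂ L x ↔
      0 < gap (L / σ₁) (L / σ₂) (‖x₂ - x₁‖ / 2) ‖x - x₁‖ ‖x - x₂‖ := by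
  obtain ⟨⟨ha, hb⟩, hne⟩ := hx
  rw [mem_closedBall, dist_eq_norm] at ha hb
  simp only [Set.mem_insert_iff, Set.mem_singleton_iff, not_or] at hne
  have ha0 : 0 < ‖x - x₁‖ := norm_pos_iff.2 (sub_ne_zero.2 hne.1)
  have hb0 : 0 < ‖x - x₂‖ := norm_pos_iff.2 (sub_ne_zero.2 hne.2)
  have hw := abs_le.1 (abs_real_inner_div_norm_mul_norm_le_one (x - x₁) (x - x₂))
  rw [psi_eq hne.1, InnerProductGeometry.angle, phiTilde, phiTilde]
  have hi := inner_sub_sub x₁ x₂ x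
  set a := ‖x - x₁‖
  set b := ‖x - x₂‖
  have ea : σ₁ / L * a = a / (L / σ₁) := by field_simp
  have eb : σ₂ / L * b = b / (L / σ₂) := by field_simp
  rw [pi_sub_arccos_lt_iff (by positivity) (by rw [ea, div_le_one (by positivity)]; exact ha)
    (by positivity) (by rw [eb, div_le_one (by positivity)]; exact hb) hw.1 hw.2, hi, ea, eb, gap]
  rw [← sub_pos, ← mul_pos_iff_of_pos_left (show 0 < a * b by positivity)]
  apply iff_of_eq
  congr 1
  field_simp
  ring

end Angles

/-! ### Coordinates along and across the axis -/

section Coordinates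

variable {m : ℕ}

theorem norm_sq_eq_tail (x : E m) : ‖x‖ ^ 2 = x 0 ^ 2 + ‖tail x‖ ^ 2 := by
  rw [EuclideanSpace.real_norm_sq_eq, EuclideanSpace.real_norm_sq_eq, Fin.sum_univ_succ]
  rfl

theorem norm_sub_axisPoint_sq (x : E m) (t : ℝ) :
    ‖x - axisPoint m t‖ ^ 2 = (x 0 - t) ^ 2 + ‖tail x‖ ^ 2 := by
  rw [norm_sq_eq_tail]
  have h : tail (x - axisPoint m t) = tail x := by
    ext i
    simp [tail, axisPoint]
  rw [h]
  simp [axisPoint]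

theorem tail_axisPoint (t : ℝ) : tail (axisPoint m t) = 0 := by
  ext i
  simp [tail, axisPoint]

theorem axisPoint_apply_zero (t : ℝ) : axisPoint m t 0 = t := by
  simp [axisPoint]

theorem eq_axisPoint_iff {x : E m} {t : ℝ} : x = axisPoint m t ↔ x 0 = t ∧ ‖tail x‖ = 0 := by
  rw [← sub_eq_zero, ← norm_eq_zero, ← sq_eq_zero_iff, norm_sub_axisPoint_sq]
  constructor
  · intro h
    constructor
    · nlinarith [sq_nonneg (x 0 - t), sq_nonneg ‖tail x‖]
    · rw [← sq_eq_zero_iff]; nlinarith [sq_nonneg (x 0 - t), sq_nonneg ‖tail x‖]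
  · rintro ⟨h, h'⟩
    rw [h, h']; ring

theorem norm_axisPoint_sub (s t : ℝ) : ‖axisPoint m s - axisPoint m t‖ = |s - t| := by
  rw [← sq_eq_sq₀ (norm_nonneg _) (abs_nonneg _), norm_sub_axisPoint_sq, tail_axisPoint,
    axisPoint_apply_zero, sq_abs]
  simp

end Coordinates

/-! ### The sets of the theorem in terms of the gap -/

namespace Params

/-- All the parameters are positive. -/
structure Pos (P : Params) : Prop where
  σ₁_pos : 0 < P.σ₁
  σ₂_pos : 0 < P.σ₂
  L_pos : 0 < P.L
  r_pos : 0 < P.r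

namespace Pos

variable {P : Params}

theorem R₁_pos (hP : P.Pos) : 0 < P.L / P.σ₁ := div_pos hP.L_pos hP.σ₁_pos

theorem R₂_pos (hP : P.Pos) : 0 < P.L / P.σ₂ := div_pos hP.L_pos hP.σ₂_pos

end Pos

variable {m : ℕ} {P : Params}

theorem norm_x₂_sub_x₁ (hP : P.Pos) : ‖P.x₂ m - P.x₁ m‖ = 2 * P.r := by
  rw [x₁, x₂, norm_axisPoint_sub, abs_of_pos] <;> linarith [hP.r_pos]

theorem norm_sub_x₁_sq (x : E m) : ‖x - P.x₁ m‖ ^ 2 = (x 0 + P.r) ^ 2 + ‖tail x‖ ^ 2 := by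
  rw [x₁, norm_sub_axisPoint_sq, sub_neg_eq_add]

theorem norm_sub_x₂_sq (x : E m) : ‖x - P.x₂ m‖ ^ 2 = (x 0 - P.r) ^ 2 + ‖tail x‖ ^ 2 :=
  norm_sub_axisPoint_sq _ _

theorem sq_sub_sq (x : E m) :
    ‖x - P.x₁ m‖ ^ 2 - ‖x - P.x₂ m‖ ^ 2 = 4 * P.r * x 0 := by
  rw [norm_sub_x₁_sq, norm_sub_x₂_sq]; ring

/-- The gap at a point. -/
noncomputable def gapAt (P : Params) (x : E m) : ℝ :=
  gap (P.L / P.σ₁) (P.L / P.σ₂) P.r ‖x - P.x₁ m‖ ‖x - P.x₂ m‖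

theorem continuous_gapAt : Continuous (P.gapAt (m := m)) :=
  continuous_gap.comp (f := fun x : E m => (‖x - P.x₁ m‖, ‖x - P.x₂ m‖)) (by fun_prop)

theorem gapAt_x₁ (hP : P.Pos) : P.gapAt (P.x₁ m) = 0 := by
  rw [gapAt, sub_self, norm_zero, ← norm_neg, neg_sub, norm_x₂_sub_x₁ hP, gap_zero_left]

theorem gapAt_x₂ (hP : P.Pos) : P.gapAt (P.x₂ m) = 0 := by
  rw [gapAt, sub_self, norm_zero, norm_x₂_sub_x₁ hP, gap_zero_right]

/-- The centres need no separate exclusion, since the gap vanishes there. -/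
theorem mem_T'_iff (hP : P.Pos) {x : E m} :
    x ∈ P.T' m ↔ ‖x - P.x₁ m‖ ≤ P.L / P.σ₁ ∧ ‖x - P.x₂ m‖ ≤ P.L / P.σ₂ ∧ 0 < P.gapAt x := by
  have key (hx : x ∈ angleDomain (P.x₁ m) (P.x₂ m) P.σ₁ P.σ₂ P.L) :=
    psi_lt_iff hP.σ₁_pos hP.σ₂_pos hP.L_pos hx
  rw [norm_x₂_sub_x₁ hP, show 2 * P.r / 2 = P.r by ring] at key
  constructor
  · rintro ⟨hx, h⟩
    have ha := hx.1.1
    have hb := hx.1.2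
    rw [mem_closedBall, dist_eq_norm] at ha hb
    exact ⟨ha, hb, (key hx).1 h⟩
  · rintro ⟨ha, hb, h⟩
    have hx : x ∈ angleDomain (P.x₁ m) (P.x₂ m) P.σ₁ P.σ₂ P.L := by
      refine ⟨⟨by rwa [mem_closedBall, dist_eq_norm], by rwa [mem_closedBall, dist_eq_norm]⟩, ?_⟩
      rintro (rfl | rfl)
      · exact h.ne' (gapAt_x₁ hP)
      · exact h.ne' (gapAt_x₂ hP)
    exact ⟨hx, (key hx).2 h⟩

theorem mem_M_iff (hP : P.Pos)
    (hd : 2 * P.r ≠ P.L / P.σ₁ + P.L / P.σ₂) {x : E m} :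
    x ∈ P.M m ↔ ‖x - P.x₁ m‖ ≤ P.L / P.σ₁ ∧ ‖x - P.x₂ m‖ ≤ P.L / P.σ₂ ∧ 0 < P.gapAt x := by
  rw [← mem_T'_iff hP]
  constructor
  · rintro (h | h)
    · exact h
    · refine absurd h.1 ?_
      rw [norm_x₂_sub_x₁ hP]
      contrapose! hd
      rw [hd]; ring
  · exact Or.inl

theorem mem_T_iff (hP : P.Pos) {x : E m} :
    x ∈ P.T m ↔ (x ≠ P.x₁ m ∧ x ≠ P.x₂ m) ∧
      ‖x - P.x₁ m‖ ≤ P.L / P.σ₁ ∧ ‖x - P.x₂ m‖ ≤ P.L / P.σ₂ ∧ P.gapAt x = 0 := by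
  have hD : x ∈ angleDomain (P.x₁ m) (P.x₂ m) P.σ₁ P.σ₂ P.L ↔ (x ≠ P.x₁ m ∧ x ≠ P.x₂ m) ∧
      ‖x - P.x₁ m‖ ≤ P.L / P.σ₁ ∧ ‖x - P.x₂ m‖ ≤ P.L / P.σ₂ := by
    simp only [angleDomain, Set.mem_sdiff, Set.mem_inter_iff, mem_closedBall, dist_eq_norm,
      Set.mem_insert_iff, Set.mem_singleton_iff, not_or, ne_eq]
    tauto
  rw [T, Set.mem_ofPred_eq, hD, and_assoc (a := _ ≠ _ ∧ _ ≠ _), and_assoc (a := _ ≤ _)]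
  refine and_congr_right fun hne => and_congr_right fun _ => and_congr_right fun _ => ?_
  obtain ⟨hσ₁, hσ₂, hL, _⟩ := hP
  have ha0 : 0 < ‖x - P.x₁ m‖ := norm_pos_iff.2 (sub_ne_zero.2 hne.1)
  have hb0 : 0 < ‖x - P.x₂ m‖ := norm_pos_iff.2 (sub_ne_zero.2 hne.2)
  have hx : ‖x‖ ^ 2 - P.r ^ 2
      = (‖x - P.x₁ m‖ ^ 2 + ‖x - P.x₂ m‖ ^ 2 - 4 * P.r ^ 2) / 2 := by
    rw [norm_sub_x₁_sq, norm_sub_x₂_sq, norm_sq_eq_tail]; ring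
  rw [hx, gapAt, gap]
  set a := ‖x - P.x₁ m‖
  set b := ‖x - P.x₂ m‖
  have aux {s c : ℝ} (hs : 0 < s) (hc : 0 < c) :
      √(1 / c ^ 2 - s ^ 2 / P.L ^ 2) = √(1 - (c / (P.L / s)) ^ 2) / c := by
    have e : 1 / c ^ 2 - s ^ 2 / P.L ^ 2 = (1 - (c / (P.L / s)) ^ 2) / c ^ 2 := by field_simp
    rw [e, sqrt_div' _ (by positivity), sqrt_sq hc.le]
  rw [aux hσ₁ ha0, aux hσ₂ hb0]
  set u := √(1 - (a / (P.L / P.σ₁)) ^ 2)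
  set v := √(1 - (b / (P.L / P.σ₂)) ^ 2)
  -- Multiplied by `a² b²`, the equation defining `T` says that the gap is zero.
  rw [eq_comm, ← sub_eq_zero, ← mul_eq_zero_iff_left (a := a ^ 2 * b ^ 2) (by positivity)]
  apply iff_of_eq
  congr 1
  field_simp
  ring

/-- Since `a² - b² = 4 r x₁`, the plane `x₁ = λ₁` meets the sphere `a = R₁` exactly where `b²`
equals `capBound`. -/
theorem lam₁_eq (hP : P.Pos) : 4 * P.r * P.lam₁
    = (P.L / P.σ₁) ^ 2 - capBound (P.L / P.σ₁) (P.L / P.σ₂) P.r := by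
  obtain ⟨_, _, _, _⟩ := hP
  unfold lam₁ β γ₁ capBound
  field_simp
  ring

theorem lam₂_eq (hP : P.Pos) : 4 * P.r * P.lam₂
    = capBound (P.L / P.σ₂) (P.L / P.σ₁) P.r - (P.L / P.σ₂) ^ 2 := by
  obtain ⟨_, _, _, _⟩ := hP
  unfold lam₂ β γ₂ capBound
  field_simp
  ring

open Filter Topology

theorem lam₁_le_iff (hP : P.Pos) {x : E m} : P.lam₁ ≤ x 0 ↔
    (P.L / P.σ₁) ^ 2 - capBound (P.L / P.σ₁) (P.L / P.σ₂) P.r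
      ≤ ‖x - P.x₁ m‖ ^ 2 - ‖x - P.x₂ m‖ ^ 2 := by
  have := hP.r_pos
  rw [sq_sub_sq, ← lam₁_eq hP, mul_le_mul_iff_of_pos_left (by positivity)]

theorem lam₁_lt_iff (hP : P.Pos) {x : E m} : P.lam₁ < x 0 ↔
    (P.L / P.σ₁) ^ 2 - capBound (P.L / P.σ₁) (P.L / P.σ₂) P.r
      < ‖x - P.x₁ m‖ ^ 2 - ‖x - P.x₂ m‖ ^ 2 := by
  have := hP.r_pos
  rw [sq_sub_sq, ← lam₁_eq hP, mul_lt_mul_iff_of_pos_left (by positivity)]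

theorem le_lam₂_iff (hP : P.Pos) {x : E m} : x 0 ≤ P.lam₂ ↔
    (P.L / P.σ₂) ^ 2 - capBound (P.L / P.σ₂) (P.L / P.σ₁) P.r
      ≤ ‖x - P.x₂ m‖ ^ 2 - ‖x - P.x₁ m‖ ^ 2 := by
  have := hP.r_pos
  rw [← neg_sub (‖x - P.x₁ m‖ ^ 2), sq_sub_sq, ← neg_sub (capBound _ _ _), ← lam₂_eq hP,
    neg_le_neg_iff, mul_le_mul_iff_of_pos_left (by positivity)]

theorem lt_lam₂_iff (hP : P.Pos) {x : E m} : x 0 < P.lam₂ ↔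
    (P.L / P.σ₂) ^ 2 - capBound (P.L / P.σ₂) (P.L / P.σ₁) P.r
      < ‖x - P.x₂ m‖ ^ 2 - ‖x - P.x₁ m‖ ^ 2 := by
  have := hP.r_pos
  rw [← neg_sub (‖x - P.x₁ m‖ ^ 2), sq_sub_sq, ← neg_sub (capBound _ _ _), ← lam₂_eq hP,
    neg_lt_neg_iff, mul_lt_mul_iff_of_pos_left (by positivity)]

/-! ### Caps of the balls and the sign of the gap on the spheres -/

theorem cap₁ (hP : P.Pos) (hd : 2 * P.r < P.L / P.σ₁ + P.L / P.σ₂) {x : E m}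
    (ha : ‖x - P.x₁ m‖ ≤ P.L / P.σ₁) (h : P.lam₁ ≤ x 0)
    (hs : ‖x - P.x₁ m‖ < P.L / P.σ₁ ∨ P.lam₁ < x 0) :
    ‖x - P.x₂ m‖ < P.L / P.σ₂ ∧ 0 < P.gapAt x := by
  rw [lam₁_le_iff hP] at h
  rw [lam₁_lt_iff hP] at hs
  exact ⟨lt_of_mem_cap hP.R₁_pos hP.R₂_pos hP.r_pos hd (norm_nonneg _) ha h,
    gap_pos_of_mem_cap hP.R₁_pos hP.R₂_pos (norm_nonneg _) (norm_nonneg _) ha h hs⟩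

theorem cap₂ (hP : P.Pos) (hd : 2 * P.r < P.L / P.σ₁ + P.L / P.σ₂) {x : E m}
    (hb : ‖x - P.x₂ m‖ ≤ P.L / P.σ₂) (h : x 0 ≤ P.lam₂)
    (hs : ‖x - P.x₂ m‖ < P.L / P.σ₂ ∨ x 0 < P.lam₂) :
    ‖x - P.x₁ m‖ < P.L / P.σ₁ ∧ 0 < P.gapAt x := by
  rw [le_lam₂_iff hP] at h
  rw [lt_lam₂_iff hP] at hs
  rw [add_comm] at hd
  rw [gapAt, gap_comm]
  exact ⟨lt_of_mem_cap hP.R₂_pos hP.R₁_pos hP.r_pos hd (norm_nonneg _) hb h,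
    gap_pos_of_mem_cap hP.R₂_pos hP.R₁_pos (norm_nonneg _) (norm_nonneg _) hb h hs⟩

theorem gapAt_pos_iff₁ (hP : P.Pos) {x : E m} (ha : ‖x - P.x₁ m‖ = P.L / P.σ₁) :
    0 < P.gapAt x ↔ P.lam₁ < x 0 := by
  rw [lam₁_lt_iff hP, gapAt, ha, gap_left_pos_iff hP.R₁_pos hP.R₂_pos]
  constructor <;> intro h <;> linarith

theorem gapAt_nonneg_iff₁ (hP : P.Pos) {x : E m} (ha : ‖x - P.x₁ m‖ = P.L / P.σ₁) :
    0 ≤ P.gapAt x ↔ P.lam₁ ≤ x 0 := by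
  rw [lam₁_le_iff hP, gapAt, ha, gap_left_nonneg_iff hP.R₁_pos hP.R₂_pos]
  constructor <;> intro h <;> linarith

theorem gapAt_pos_iff₂ (hP : P.Pos) {x : E m} (hb : ‖x - P.x₂ m‖ = P.L / P.σ₂) :
    0 < P.gapAt x ↔ x 0 < P.lam₂ := by
  rw [lt_lam₂_iff hP, gapAt, gap_comm, hb, gap_left_pos_iff hP.R₂_pos hP.R₁_pos]
  constructor <;> intro h <;> linarith

theorem gapAt_nonneg_iff₂ (hP : P.Pos) {x : E m} (hb : ‖x - P.x₂ m‖ = P.L / P.σ₂) :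
    0 ≤ P.gapAt x ↔ x 0 ≤ P.lam₂ := by
  rw [le_lam₂_iff hP, gapAt, gap_comm, hb, gap_left_nonneg_iff hP.R₂_pos hP.R₁_pos]
  constructor <;> intro h <;> linarith

/-- Makes the two caps disjoint: `4 r λ₂ < R₁² - R₂² < 4 r λ₁` by the bounds on `capBound`. -/
theorem lam₂_lt_lam₁ (hP : P.Pos) (hd : 2 * P.r < P.L / P.σ₁ + P.L / P.σ₂) :
    P.lam₂ < P.lam₁ := by
  have h := hP.r_pos
  rw [← mul_lt_mul_iff_of_pos_left (show 0 < 4 * P.r by positivity), lam₁_eq hP, lam₂_eq hP]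
  have h1 := capBound_lt hP.R₁_pos hP.R₂_pos h hd
  have h2 := capBound_lt hP.R₂_pos hP.R₁_pos h (by rwa [add_comm])
  linarith

/-- When the first ball reaches the other centre, `capBound` is nonpositive, so the cap forces `b =
0`. -/
theorem eq_x₂_of_cap (hP : P.Pos) (hd : 2 * P.r ≤ P.L / P.σ₁) {x : E m}
    (ha : ‖x - P.x₁ m‖ ≤ P.L / P.σ₁) (h : P.lam₁ ≤ x 0) : x = P.x₂ m ∧ x 0 ≤ P.lam₁ := by
  have h0 := capBound_nonpos hP.R₁_pos hP.R₂_pos hP.r_pos hd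
  have h1 := (lam₁_le_iff hP).1 h
  have h2 : ‖x - P.x₁ m‖ ^ 2 ≤ (P.L / P.σ₁) ^ 2 := by gcongr
  have h3 : ‖x - P.x₂ m‖ ^ 2 = 0 := by nlinarith [sq_nonneg ‖x - P.x₂ m‖]
  constructor
  · rwa [sq_eq_zero_iff, norm_eq_zero, sub_eq_zero] at h3
  · rw [← not_lt, lam₁_lt_iff hP]; linarith

theorem eq_x₁_of_cap (hP : P.Pos) (hd : 2 * P.r ≤ P.L / P.σ₂) {x : E m}
    (hb : ‖x - P.x₂ m‖ ≤ P.L / P.σ₂) (h : x 0 ≤ P.lam₂) : x = P.x₁ m ∧ P.lam₂ ≤ x 0 := by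
  have h0 := capBound_nonpos hP.R₂_pos hP.R₁_pos hP.r_pos hd
  have h1 := (le_lam₂_iff hP).1 h
  have h2 : ‖x - P.x₂ m‖ ^ 2 ≤ (P.L / P.σ₂) ^ 2 := by gcongr
  have h3 : ‖x - P.x₁ m‖ ^ 2 = 0 := by nlinarith [sq_nonneg ‖x - P.x₁ m‖]
  constructor
  · rwa [sq_eq_zero_iff, norm_eq_zero, sub_eq_zero] at h3
  · rw [← not_lt, lt_lam₂_iff hP]; linarith

/-! ### Closure and interior -/

/-- The sublevel description of `M↓`. -/
def region (P : Params) (m : ℕ) : Set (E m) :=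
  {x | ‖x - P.x₁ m‖ ≤ P.L / P.σ₁ ∧ ‖x - P.x₂ m‖ ≤ P.L / P.σ₂ ∧ 0 < P.gapAt x}

theorem mem_region_axisPoint (hP : P.Pos) (hd : 2 * P.r < P.L / P.σ₁ + P.L / P.σ₂) {t : ℝ}
    (h1 : -P.r < t) (h2 : t < P.r) (ha : t + P.r ≤ P.L / P.σ₁) (hb : P.r - t ≤ P.L / P.σ₂) :
    axisPoint m t ∈ P.region m := by
  have ea : ‖axisPoint m t - P.x₁ m‖ = t + P.r := by
    rw [x₁, norm_axisPoint_sub, abs_of_pos] <;> linarith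
  have eb : ‖axisPoint m t - P.x₂ m‖ = P.r - t := by
    rw [x₂, norm_axisPoint_sub, abs_of_neg] <;> linarith
  refine ⟨by rwa [ea], by rwa [eb], ?_⟩
  rw [gapAt, ea, eb]
  exact gap_pos_of_add_eq hP.R₁_pos hP.R₂_pos hd (by linarith) (by linarith) ha hb (by ring)

theorem continuous_axisPoint : Continuous (axisPoint m) := by
  refine (Isometry.of_dist_eq fun s t => ?_).continuous
  rw [dist_eq_norm, norm_axisPoint_sub, Real.dist_eq]

theorem x₁_mem_closure_region (hP : P.Pos) (hd : 2 * P.r ≤ P.L / P.σ₂) :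
    P.x₁ m ∈ closure (P.region m) := by
  have hr := hP.r_pos
  have hR := hP.R₁_pos
  refine mem_closure_of_tendsto (continuous_axisPoint.continuousWithinAt (s := Set.Ioi (-P.r))) ?_
  have hlt : -P.r < min P.r (P.L / P.σ₁ - P.r) := lt_min (by linarith) (by linarith)
  filter_upwards [Ioo_mem_nhdsGT hlt] with t ht
  have := lt_min_iff.1 ht.2
  exact mem_region_axisPoint hP (by linarith) ht.1 this.1 (by linarith) (by linarith [ht.1])

theorem x₂_mem_closure_region (hP : P.Pos) (hd : 2 * P.r ≤ P.L / P.σ₁) :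
    P.x₂ m ∈ closure (P.region m) := by
  have hr := hP.r_pos
  have hR := hP.R₂_pos
  refine mem_closure_of_tendsto (continuous_axisPoint.continuousWithinAt (s := Set.Iio P.r)) ?_
  have hlt : max (-P.r) (P.r - P.L / P.σ₂) < P.r := max_lt (by linarith) (by linarith)
  filter_upwards [Ioo_mem_nhdsLT hlt] with t ht
  have := max_lt_iff.1 ht.1
  exact mem_region_axisPoint hP (by linarith) this.1 ht.2 (by linarith [ht.2]) (by linarith)

theorem mem_closure_region_of_tail_ne_zero (hP : P.Pos) {x : E m} (hx : ‖tail x‖ ≠ 0)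
    (ha : ‖x - P.x₁ m‖ ≤ P.L / P.σ₁) (hb : ‖x - P.x₂ m‖ ≤ P.L / P.σ₂) (h : P.gapAt x = 0) :
    x ∈ closure (P.region m) := by
  have hρ : 0 < ‖tail x‖ := lt_of_le_of_ne (norm_nonneg _) hx.symm
  have hA := norm_sub_x₁_sq (P := P) x
  have hB := norm_sub_x₂_sq (P := P) x
  have hAB := sq_sub_sq (P := P) x
  have ha0 : 0 < ‖x - P.x₁ m‖ := by
    apply lt_of_le_of_ne (norm_nonneg _)
    intro h0
    rw [← h0] at hA
    nlinarith [sq_nonneg (x 0 + P.r)]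
  have hb0 : 0 < ‖x - P.x₂ m‖ := by
    apply lt_of_le_of_ne (norm_nonneg _)
    intro h0
    rw [← h0] at hB
    nlinarith [sq_nonneg (x 0 - P.r)]
  -- `y k` is to have distances `k a` and `k b`. Then `a² - b² = 4 r x₁` forces the first coordinate
  -- `k² x₁`, and `rad k` is the squared length left for the tail, taken in the direction of `tail
  -- x`.
  let rad : ℝ → ℝ := fun k => (k * ‖x - P.x₁ m‖) ^ 2 - (k ^ 2 * x 0 + P.r) ^ 2
  let μ : ℝ → ℝ := fun k => √(rad k) / ‖tail x‖
  -- The axis term corrects the first coordinate from `μ k * x 0` to `k ^ 2 * x 0`.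
  let y : ℝ → E m := fun k => μ k • x + axisPoint m ((k ^ 2 - μ k) * x 0)
  have hradc : Continuous rad := by unfold rad; fun_prop
  have hμc : Continuous μ := by unfold μ; fun_prop
  have hyc : Continuous y :=
    (hμc.smul continuous_const).add (continuous_axisPoint.comp (by fun_prop))
  have hrad1 : rad 1 = ‖tail x‖ ^ 2 := by unfold rad; rw [one_mul, hA]; ring
  have hμ1 : μ 1 = 1 := by unfold μ; rw [hrad1, sqrt_sq hρ.le, div_self hx]
  have hy1 : y 1 = x := by simp [y, hμ1, axisPoint]
  have hy0 (k : ℝ) : y k 0 = k ^ 2 * x 0 := by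
    simp [y, axisPoint]; ring
  have hyt (k : ℝ) : tail (y k) = μ k • tail x := by
    ext i
    simp [y, axisPoint, tail]
  have hlim : Tendsto y (𝓝[<] 1) (𝓝 x) := by
    have := hyc.continuousWithinAt (s := Set.Iio 1) (x := 1)
    rwa [ContinuousWithinAt, hy1] at this
  refine mem_closure_of_tendsto hlim ?_
  have hpos : ∀ᶠ k in 𝓝[<] (1 : ℝ), 0 < rad k :=
    (hradc.continuousWithinAt (s := Set.Iio 1) (x := 1)).eventually_const_lt
      (by rw [hrad1]; positivity)
  filter_upwards [hpos, Ioo_mem_nhdsLT (zero_lt_one (α := ℝ))] with k hk hk1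
  have hk0 : 0 < k := hk1.1
  have eA : ‖y k - P.x₁ m‖ = k * ‖x - P.x₁ m‖ := by
    rw [← sq_eq_sq₀ (norm_nonneg _) (by positivity), norm_sub_x₁_sq, hy0, hyt, norm_smul, mul_pow,
      norm_eq_abs, sq_abs]
    unfold μ
    rw [div_pow, sq_sqrt hk.le, div_mul_cancel₀ _ (by positivity)]
    unfold rad
    ring
  have eB : ‖y k - P.x₂ m‖ = k * ‖x - P.x₂ m‖ := by
    rw [← sq_eq_sq₀ (norm_nonneg _) (by positivity)]
    have := sq_sub_sq (P := P) (y k)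
    rw [eA, hy0] at this
    linear_combination -this + k ^ 2 * hAB
  refine ⟨?_, ?_, ?_⟩
  · rw [eA]; nlinarith [hk1.2]
  · rw [eB]; nlinarith [hk1.2]
  · rw [gapAt, eA, eB]
    exact gap_scale_pos hP.R₁_pos hP.R₂_pos hP.r_pos ha0 hb0 h hk0 hk1.2

/-- On the axis the gap is positive strictly between the centres and negative outside the segment.
-/
theorem eq_center_of_tail_eq_zero (hP : P.Pos) (hd : 2 * P.r < P.L / P.σ₁ + P.L / P.σ₂) {x : E m}
    (hx : ‖tail x‖ = 0) (ha : ‖x - P.x₁ m‖ ≤ P.L / P.σ₁) (hb : ‖x - P.x₂ m‖ ≤ P.L / P.σ₂)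
    (h : P.gapAt x = 0) : x = P.x₁ m ∨ x = P.x₂ m := by
  by_contra! hne
  have ha0 : 0 < ‖x - P.x₁ m‖ := norm_pos_iff.2 (sub_ne_zero.2 hne.1)
  have hb0 : 0 < ‖x - P.x₂ m‖ := norm_pos_iff.2 (sub_ne_zero.2 hne.2)
  have eA : ‖x - P.x₁ m‖ = |x 0 + P.r| := by
    rw [← sq_eq_sq₀ (norm_nonneg _) (abs_nonneg _), norm_sub_x₁_sq, hx, sq_abs]; ring
  have eB : ‖x - P.x₂ m‖ = |x 0 - P.r| := by
    rw [← sq_eq_sq₀ (norm_nonneg _) (abs_nonneg _), norm_sub_x₂_sq, hx, sq_abs]; ring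
  have hr := hP.r_pos
  have neg := gap_neg_of_sub_sq (r := P.r) hP.R₁_pos hP.R₂_pos ha0 hb0
  have pos := gap_pos_of_add_eq (r := P.r) hP.R₁_pos hP.R₂_pos hd ha0 hb0 ha hb
  rw [← gapAt, h] at neg pos
  rcases le_total 0 (x 0 + P.r) with h1 | h1 <;> rcases le_total 0 (x 0 - P.r) with h2 | h2
  · exact (neg (by rw [eA, eB, abs_of_nonneg h1, abs_of_nonneg h2]; ring)).false
  · exact (pos (by rw [eA, eB, abs_of_nonneg h1, abs_of_nonpos h2]; ring)).false
  · linarith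
  · exact (neg (by rw [eA, eB, abs_of_nonpos h1, abs_of_nonpos h2]; ring)).false

theorem mem_closure_region_iff (hP : P.Pos) (hd : 2 * P.r < P.L / P.σ₁ + P.L / P.σ₂) {x : E m} :
    x ∈ closure (P.region m) ↔
      ‖x - P.x₁ m‖ ≤ P.L / P.σ₁ ∧ ‖x - P.x₂ m‖ ≤ P.L / P.σ₂ ∧ 0 ≤ P.gapAt x := by
  constructor
  · have hcl : IsClosed {x : E m |
        ‖x - P.x₁ m‖ ≤ P.L / P.σ₁ ∧ ‖x - P.x₂ m‖ ≤ P.L / P.σ₂ ∧ 0 ≤ P.gapAt x} :=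
      (isClosed_le (by fun_prop) continuous_const).and
        ((isClosed_le (by fun_prop) continuous_const).and
          (isClosed_le continuous_const continuous_gapAt))
    refine fun h => closure_minimal (s := P.region m) ?_ hcl h
    exact fun y hy => ⟨hy.1, hy.2.1, hy.2.2.le⟩
  · rintro ⟨ha, hb, h⟩
    rcases h.lt_or_eq with h | h
    · exact subset_closure ⟨ha, hb, h⟩
    by_cases hx : ‖tail x‖ = 0
    · rcases eq_center_of_tail_eq_zero hP hd hx ha hb h.symm with rfl | rfl
      · apply x₁_mem_closure_region hP
        rwa [← norm_neg, neg_sub, norm_x₂_sub_x₁ hP] at hb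
      · apply x₂_mem_closure_region hP
        rwa [norm_x₂_sub_x₁ hP] at ha
    · exact mem_closure_region_of_tail_ne_zero hP hx ha hb h.symm

theorem mem_interior_region_iff (hP : P.Pos) {x : E m} :
    x ∈ interior (P.region m) ↔
      ‖x - P.x₁ m‖ < P.L / P.σ₁ ∧ ‖x - P.x₂ m‖ < P.L / P.σ₂ ∧ 0 < P.gapAt x := by
  constructor
  · intro h
    have h1 : P.region m ⊆ closedBall (P.x₁ m) (P.L / P.σ₁) := fun y hy => by
      rw [mem_closedBall, dist_eq_norm]; exact hy.1
    have h2 : P.region m ⊆ closedBall (P.x₂ m) (P.L / P.σ₂) := fun y hy => by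
      rw [mem_closedBall, dist_eq_norm]; exact hy.2.1
    have h1 := interior_mono h1 h
    have h2 := interior_mono h2 h
    rw [interior_closedBall _ hP.R₁_pos.ne', mem_ball, dist_eq_norm] at h1
    rw [interior_closedBall _ hP.R₂_pos.ne', mem_ball, dist_eq_norm] at h2
    exact ⟨h1, h2, (interior_subset h).2.2⟩
  · have hop : IsOpen {x : E m |
        ‖x - P.x₁ m‖ < P.L / P.σ₁ ∧ ‖x - P.x₂ m‖ < P.L / P.σ₂ ∧ 0 < P.gapAt x} :=
      (isOpen_lt (by fun_prop) continuous_const).and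
        ((isOpen_lt (by fun_prop) continuous_const).and
          (isOpen_lt continuous_const continuous_gapAt))
    refine fun h => interior_maximal (s := P.region m) ?_ hop h
    exact fun y hy => ⟨hy.1.le, hy.2.1.le, hy.2.2⟩

/-! ### The circles as intersections of sphere and plane -/

/-- The two hypotheses give the two factors of the radicand opposite signs, so the square root is
genuine. -/
theorem nu₁_sq (hP : P.Pos) (h : P.L / P.σ₁ ≤ 2 * P.r)
    (hd : 2 * P.r ≤ P.L / P.σ₁ + P.L / P.σ₂) :
    P.nu₁ ^ 2 = (P.L / P.σ₁) ^ 2 - (P.lam₁ + P.r) ^ 2 := by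
  obtain ⟨hσ₁, hσ₂, hL, hr⟩ := hP
  have h1 : P.γ₁ / P.r ^ 2 - 4 ≤ 0 := by
    have : (P.L / P.σ₁) ^ 2 ≤ (2 * P.r) ^ 2 := by gcongr
    rw [sub_nonpos, div_le_iff₀ (by positivity), γ₁, ← div_pow]
    linarith
  have h2 : 0 ≤ (1 + P.β) ^ 2 * (P.γ₁ / P.r ^ 2) - 4 * P.β ^ 2 := by
    -- `R₂ β = R₁`, hence `(R₁ + R₂) β = (1 + β) R₁`.
    have e : 2 * P.r * P.β ≤ (1 + P.β) * (P.L / P.σ₁) := by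
      have hβ : 0 < P.β := div_pos hσ₂ hσ₁
      calc 2 * P.r * P.β ≤ (P.L / P.σ₁ + P.L / P.σ₂) * P.β := by gcongr
        _ = _ := by unfold β; field_simp; ring
    have hβ : 0 < P.β := div_pos hσ₂ hσ₁
    have := pow_le_pow_left₀ (by positivity) e 2
    rw [sub_nonneg, mul_div_assoc', le_div_iff₀ (by positivity), γ₁, ← div_pow]
    linarith
  rw [nu₁, mul_pow, sq_sqrt (mul_nonneg (by linarith) h2), lam₁, γ₁, β]
  field_simp
  ring

theorem nu₂_sq (hP : P.Pos) (h : P.L / P.σ₂ ≤ 2 * P.r)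
    (hd : 2 * P.r ≤ P.L / P.σ₁ + P.L / P.σ₂) :
    P.nu₂ ^ 2 = (P.L / P.σ₂) ^ 2 - (P.lam₂ - P.r) ^ 2 := by
  obtain ⟨hσ₁, hσ₂, hL, hr⟩ := hP
  have h1 : P.γ₂ / P.r ^ 2 - 4 ≤ 0 := by
    have : (P.L / P.σ₂) ^ 2 ≤ (2 * P.r) ^ 2 := by gcongr
    rw [sub_nonpos, div_le_iff₀ (by positivity), γ₂, ← div_pow]
    linarith
  have h2 : 0 ≤ (1 + P.β) ^ 2 * (P.γ₂ / P.r ^ 2) - 4 := by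
    have e : 2 * P.r ≤ (1 + P.β) * (P.L / P.σ₂) := by
      calc 2 * P.r ≤ P.L / P.σ₁ + P.L / P.σ₂ := hd
        _ = _ := by unfold β; field_simp; ring
    have := pow_le_pow_left₀ (by positivity) e 2
    rw [sub_nonneg, mul_div_assoc', le_div_iff₀ (by positivity), γ₂, ← div_pow]
    linarith
  rw [nu₂, mul_pow, sq_sqrt (mul_nonneg (by linarith) h2), lam₂, γ₂, β]
  field_simp
  ring

theorem nu₁_nonneg (hP : P.Pos) : 0 ≤ P.nu₁ := by
  obtain ⟨_, _, _, _⟩ := hP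
  unfold nu₁ β; positivity

theorem nu₂_nonneg (hP : P.Pos) : 0 ≤ P.nu₂ := by
  obtain ⟨_, _, _, _⟩ := hP
  unfold nu₂ β; positivity

theorem mem_C₁_iff (hP : P.Pos) (h : P.L / P.σ₁ ≤ 2 * P.r)
    (hd : 2 * P.r ≤ P.L / P.σ₁ + P.L / P.σ₂) {x : E m} :
    x ∈ P.C₁ m ↔ x 0 = P.lam₁ ∧ ‖x - P.x₁ m‖ = P.L / P.σ₁ := by
  refine and_congr_right fun h0 => ?_
  rw [← sq_eq_sq₀ (norm_nonneg _) (nu₁_nonneg hP), ← sq_eq_sq₀ (norm_nonneg _) hP.R₁_pos.le,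
    nu₁_sq hP h hd, norm_sub_x₁_sq, h0]
  constructor <;> intro h <;> linarith

theorem mem_C₂_iff (hP : P.Pos) (h : P.L / P.σ₂ ≤ 2 * P.r)
    (hd : 2 * P.r ≤ P.L / P.σ₁ + P.L / P.σ₂) {x : E m} :
    x ∈ P.C₂ m ↔ x 0 = P.lam₂ ∧ ‖x - P.x₂ m‖ = P.L / P.σ₂ := by
  refine and_congr_right fun h0 => ?_
  rw [← sq_eq_sq₀ (norm_nonneg _) (nu₂_nonneg hP), ← sq_eq_sq₀ (norm_nonneg _) hP.R₂_pos.le,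
    nu₂_sq hP h hd, norm_sub_x₂_sq, h0]
  constructor <;> intro h <;> linarith

/-! ### Frontier and interior of `M↓`, and its closed pieces -/

theorem M_eq_region (hP : P.Pos) (hd : 2 * P.r ≠ P.L / P.σ₁ + P.L / P.σ₂) :
    P.M m = P.region m :=
  Set.ext fun _ => mem_M_iff hP hd

theorem mem_frontier_M_iff (hP : P.Pos) (hd : 2 * P.r < P.L / P.σ₁ + P.L / P.σ₂) {x : E m} :
    x ∈ frontier (P.M m) ↔
      (‖x - P.x₁ m‖ ≤ P.L / P.σ₁ ∧ ‖x - P.x₂ m‖ ≤ P.L / P.σ₂ ∧ 0 ≤ P.gapAt x) ∧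
      ¬ (‖x - P.x₁ m‖ < P.L / P.σ₁ ∧ ‖x - P.x₂ m‖ < P.L / P.σ₂ ∧ 0 < P.gapAt x) := by
  rw [M_eq_region hP hd.ne, frontier, Set.mem_sdiff, mem_closure_region_iff hP hd,
    mem_interior_region_iff hP]

theorem mem_interior_M_iff (hP : P.Pos) (hd : 2 * P.r ≠ P.L / P.σ₁ + P.L / P.σ₂) {x : E m} :
    x ∈ interior (P.M m) ↔
      ‖x - P.x₁ m‖ < P.L / P.σ₁ ∧ ‖x - P.x₂ m‖ < P.L / P.σ₂ ∧ 0 < P.gapAt x := by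
  rw [M_eq_region hP hd, mem_interior_region_iff hP]

theorem mem_B₁_iff {x : E m} : x ∈ P.B₁ m ↔ ‖x - P.x₁ m‖ < P.L / P.σ₁ := by
  rw [B₁, mem_ball, dist_eq_norm]

theorem mem_B₂_iff {x : E m} : x ∈ P.B₂ m ↔ ‖x - P.x₂ m‖ < P.L / P.σ₂ := by
  rw [B₂, mem_ball, dist_eq_norm]

theorem mem_frontier_B₁_iff (hP : P.Pos) {x : E m} :
    x ∈ frontier (P.B₁ m) ↔ ‖x - P.x₁ m‖ = P.L / P.σ₁ := by
  rw [B₁, frontier_ball _ hP.R₁_pos.ne', mem_sphere, dist_eq_norm]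

theorem mem_frontier_B₂_iff (hP : P.Pos) {x : E m} :
    x ∈ frontier (P.B₂ m) ↔ ‖x - P.x₂ m‖ = P.L / P.σ₂ := by
  rw [B₂, frontier_ball _ hP.R₂_pos.ne', mem_sphere, dist_eq_norm]

theorem mem_H₁p_iff {x : E m} : x ∈ P.H₁p m ↔ P.lam₁ ≤ x 0 := Iff.rfl

theorem mem_H₁m_iff {x : E m} : x ∈ P.H₁m m ↔ x 0 ≤ P.lam₁ := Iff.rfl

theorem mem_H₂p_iff {x : E m} : x ∈ P.H₂p m ↔ P.lam₂ ≤ x 0 := Iff.rfl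

theorem mem_H₂m_iff {x : E m} : x ∈ P.H₂m m ↔ x 0 ≤ P.lam₂ := Iff.rfl

theorem continuous_apply_zero : Continuous fun x : E m => x 0 := by fun_prop

theorem isClosed_H₁p : IsClosed (P.H₁p m) := isClosed_le continuous_const continuous_apply_zero

theorem isClosed_H₂m : IsClosed (P.H₂m m) := isClosed_le continuous_apply_zero continuous_const

/-- `C₁` is precisely the rim that the cap lacks in `M`. -/
theorem M_union_C₁_inter_H₁p (hP : P.Pos) (h : P.L / P.σ₁ ≤ 2 * P.r)
    (hd : 2 * P.r < P.L / P.σ₁ + P.L / P.σ₂) :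
    (P.M m ∪ P.C₁ m) ∩ P.H₁p m = closedBall (P.x₁ m) (P.L / P.σ₁) ∩ P.H₁p m := by
  ext x
  have hc := cap₁ hP hd (x := x)
  rw [Set.mem_inter_iff, Set.mem_inter_iff, Set.mem_union, mem_M_iff hP hd.ne,
    mem_C₁_iff hP h hd.le, mem_H₁p_iff, mem_closedBall, dist_eq_norm]
  generalize ‖x - P.x₁ m‖ = a, ‖x - P.x₂ m‖ = b, x 0 = t at *
  grind

theorem M_union_C₂_inter_H₂m (hP : P.Pos) (h : P.L / P.σ₂ ≤ 2 * P.r)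
    (hd : 2 * P.r < P.L / P.σ₁ + P.L / P.σ₂) :
    (P.M m ∪ P.C₂ m) ∩ P.H₂m m = closedBall (P.x₂ m) (P.L / P.σ₂) ∩ P.H₂m m := by
  ext x
  have hc := cap₂ hP hd (x := x)
  rw [Set.mem_inter_iff, Set.mem_inter_iff, Set.mem_union, mem_M_iff hP hd.ne,
    mem_C₂_iff hP h hd.le, mem_H₂m_iff, mem_closedBall, dist_eq_norm]
  generalize ‖x - P.x₁ m‖ = a, ‖x - P.x₂ m‖ = b, x 0 = t at *
  grind

theorem isOpen_M_inter {s : Set (E m)} (hs : IsOpen s) (h : P.M m ∩ s ⊆ interior (P.M m)) :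
    IsOpen (P.M m ∩ s) := by
  have e : P.M m ∩ s = interior (P.M m) ∩ s :=
    Set.Subset.antisymm (fun x hx => ⟨h hx, hx.2⟩) fun x hx => ⟨interior_subset hx.1, hx.2⟩
  rw [e]
  exact isOpen_interior.inter hs

theorem center_facts (hP : P.Pos) (x : E m) :
    (x = P.x₁ m → ‖x - P.x₁ m‖ = 0 ∧ ‖x - P.x₂ m‖ = 2 * P.r ∧ P.gapAt x = 0) ∧
      (x = P.x₂ m → ‖x - P.x₁ m‖ = 2 * P.r ∧ ‖x - P.x₂ m‖ = 0 ∧ P.gapAt x = 0) := by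
  refine ⟨?_, ?_⟩ <;> rintro rfl
  · refine ⟨by simp, ?_, gapAt_x₁ hP⟩
    rw [← norm_neg, neg_sub, norm_x₂_sub_x₁ hP]
  · exact ⟨norm_x₂_sub_x₁ hP, by simp, gapAt_x₂ hP⟩

/-! ### The five regimes of `r` -/

theorem M_of_small (hP : P.Pos) (h₁ : 2 * P.r ≤ P.L / P.σ₁) (h₂ : 2 * P.r ≤ P.L / P.σ₂) :
    IsOpen (P.M m) ∧
      (frontier (P.M m) = P.T m ∪ {P.x₁ m, P.x₂ m} ∧ Disjoint (P.T m) {P.x₁ m, P.x₂ m}) ∧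
      interior (P.M m) = P.T' m := by
  have R₁ := hP.R₁_pos
  have R₂ := hP.R₂_pos
  have hd : 2 * P.r < P.L / P.σ₁ + P.L / P.σ₂ := by linarith
  have hM : P.M m = P.T' m := by
    ext x
    rw [mem_M_iff hP hd.ne, mem_T'_iff hP]
  have hi : interior (P.M m) = P.T' m := by
    ext x
    rw [mem_interior_M_iff hP hd.ne, mem_T'_iff hP]
    have p₁ := gapAt_pos_iff₁ hP (x := x)
    have p₂ := gapAt_pos_iff₂ hP (x := x)
    have e₁ := eq_x₂_of_cap hP h₁ (x := x)
    have e₂ := eq_x₁_of_cap hP h₂ (x := x)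
    -- The distances and the first coordinate become free reals; the geometry survives only in the
    -- facts just collected.
    generalize ‖x - P.x₁ m‖ = a, ‖x - P.x₂ m‖ = b, x 0 = t at *
    grind
  refine ⟨?_, ⟨?_, ?_⟩, hi⟩
  · rw [← interior_eq_iff_isOpen, hi, hM]
  · ext x
    rw [mem_frontier_M_iff hP hd, Set.mem_union, mem_T_iff hP, Set.mem_insert_iff,
      Set.mem_singleton_iff]
    have p₁ := gapAt_nonneg_iff₁ hP (x := x)
    have p₂ := gapAt_nonneg_iff₂ hP (x := x)
    have e₁ := eq_x₂_of_cap hP h₁ (x := x)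
    have e₂ := eq_x₁_of_cap hP h₂ (x := x)
    have c := center_facts hP x
    generalize ‖x - P.x₁ m‖ = a, ‖x - P.x₂ m‖ = b, x 0 = t at *
    grind
  · rw [Set.disjoint_left]
    intro x hx
    rw [mem_T_iff hP] at hx
    simpa using hx.1

theorem M_of_medium (hP : P.Pos) (h₁ : P.L / P.σ₁ < 2 * P.r) (h₂ : 2 * P.r ≤ P.L / P.σ₂) :
    IsClosed ((P.M m ∪ P.C₁ m) ∩ P.H₁p m) ∧
      IsOpen (P.M m ∩ (P.H₁p m)ᶜ) ∧
      (frontier (P.M m) = (frontier (P.B₁ m) ∩ (P.H₁m m)ᶜ) ∪ P.T m ∪ {P.x₁ m} ∧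
        Disjoint (frontier (P.B₁ m) ∩ (P.H₁m m)ᶜ) (P.T m) ∧
        Disjoint (frontier (P.B₁ m) ∩ (P.H₁m m)ᶜ) {P.x₁ m} ∧
        Disjoint (P.T m) {P.x₁ m}) ∧
      (interior (P.M m) = (P.B₁ m ∩ (P.H₁m m)ᶜ) ∪ (P.T' m ∩ P.H₁m m) ∧
        Disjoint (P.B₁ m ∩ (P.H₁m m)ᶜ) (P.T' m ∩ P.H₁m m)) := by
  have R₁ := hP.R₁_pos
  have R₂ := hP.R₂_pos
  have hd : 2 * P.r < P.L / P.σ₁ + P.L / P.σ₂ := by linarith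
  refine ⟨?_, ?_, ⟨?_, ?_, ?_, ?_⟩, ?_, ?_⟩
  · rw [M_union_C₁_inter_H₁p hP h₁.le hd]
    exact isClosed_closedBall.inter isClosed_H₁p
  · refine isOpen_M_inter isClosed_H₁p.isOpen_compl fun x hx => ?_
    rw [Set.mem_inter_iff, mem_M_iff hP hd.ne, Set.mem_compl_iff, mem_H₁p_iff] at hx
    rw [mem_interior_M_iff hP hd.ne]
    have p₁ := gapAt_pos_iff₁ hP (x := x)
    have p₂ := gapAt_pos_iff₂ hP (x := x)
    have e₂ := eq_x₁_of_cap hP h₂ (x := x)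
    generalize ‖x - P.x₁ m‖ = a, ‖x - P.x₂ m‖ = b, x 0 = t at *
    grind
  · ext x
    rw [mem_frontier_M_iff hP hd, Set.mem_union, Set.mem_union, mem_T_iff hP,
      Set.mem_singleton_iff, Set.mem_inter_iff, mem_frontier_B₁_iff hP, Set.mem_compl_iff,
      mem_H₁m_iff]
    have p₁ := gapAt_nonneg_iff₁ hP (x := x)
    have p₁' := gapAt_pos_iff₁ hP (x := x)
    have p₂ := gapAt_nonneg_iff₂ hP (x := x)
    have k₁ := cap₁ hP hd (x := x)
    have e₂ := eq_x₁_of_cap hP h₂ (x := x)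
    have c := center_facts hP x
    generalize ‖x - P.x₁ m‖ = a, ‖x - P.x₂ m‖ = b, x 0 = t at *
    grind
  · rw [Set.disjoint_left]
    intro x
    rw [mem_T_iff hP, Set.mem_inter_iff, mem_frontier_B₁_iff hP, Set.mem_compl_iff, mem_H₁m_iff]
    have k₁ := cap₁ hP hd (x := x)
    generalize ‖x - P.x₁ m‖ = a, ‖x - P.x₂ m‖ = b, x 0 = t at *
    grind
  · rw [Set.disjoint_left]
    intro x
    rw [Set.mem_singleton_iff, Set.mem_inter_iff, mem_frontier_B₁_iff hP]
    have c := center_facts hP x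
    generalize ‖x - P.x₁ m‖ = a, ‖x - P.x₂ m‖ = b, x 0 = t at *
    grind
  · rw [Set.disjoint_left]
    intro x
    rw [mem_T_iff hP, Set.mem_singleton_iff]
    exact fun h => h.1.1
  · ext x
    rw [mem_interior_M_iff hP hd.ne, Set.mem_union, Set.mem_inter_iff, Set.mem_inter_iff,
      mem_T'_iff hP, Set.mem_compl_iff, mem_H₁m_iff, mem_B₁_iff]
    have p₁ := gapAt_pos_iff₁ hP (x := x)
    have p₂ := gapAt_pos_iff₂ hP (x := x)
    have k₁ := cap₁ hP hd (x := x)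
    have e₂ := eq_x₁_of_cap hP h₂ (x := x)
    generalize ‖x - P.x₁ m‖ = a, ‖x - P.x₂ m‖ = b, x 0 = t at *
    grind
  · exact Set.disjoint_left.2 fun x hx hx' => hx.2 hx'.2

theorem M_of_large (hP : P.Pos) (h₁ : P.L / P.σ₁ < 2 * P.r) (h₂ : P.L / P.σ₂ < 2 * P.r)
    (hd : 2 * P.r < P.L / P.σ₁ + P.L / P.σ₂) :
    IsClosed ((P.M m ∪ P.C₁ m) ∩ P.H₁p m) ∧
      IsClosed ((P.M m ∪ P.C₂ m) ∩ P.H₂m m) ∧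
      IsOpen (P.M m ∩ (P.H₁p m ∪ P.H₂m m)ᶜ) ∧
      (frontier (P.M m) =
          (frontier (P.B₁ m) ∩ (P.H₁m m)ᶜ) ∪ (frontier (P.B₂ m) ∩ (P.H₂p m)ᶜ) ∪ P.T m ∧
        Disjoint (frontier (P.B₁ m) ∩ (P.H₁m m)ᶜ) (frontier (P.B₂ m) ∩ (P.H₂p m)ᶜ) ∧
        Disjoint (frontier (P.B₁ m) ∩ (P.H₁m m)ᶜ) (P.T m) ∧
        Disjoint (frontier (P.B₂ m) ∩ (P.H₂p m)ᶜ) (P.T m)) ∧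
      (interior (P.M m) =
          (P.B₁ m ∩ (P.H₁m m)ᶜ) ∪ (P.B₂ m ∩ (P.H₂p m)ᶜ) ∪ (P.T' m ∩ (P.H₁m m ∩ P.H₂p m)) ∧
        Disjoint (P.B₁ m ∩ (P.H₁m m)ᶜ) (P.B₂ m ∩ (P.H₂p m)ᶜ) ∧
        Disjoint (P.B₁ m ∩ (P.H₁m m)ᶜ) (P.T' m ∩ (P.H₁m m ∩ P.H₂p m)) ∧
        Disjoint (P.B₂ m ∩ (P.H₂p m)ᶜ) (P.T' m ∩ (P.H₁m m ∩ P.H₂p m))) := by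
  have hH : Disjoint (P.H₁m m)ᶜ (P.H₂p m)ᶜ := by
    rw [Set.disjoint_left]
    intro x
    rw [Set.mem_compl_iff, Set.mem_compl_iff, mem_H₁m_iff, mem_H₂p_iff]
    have := lam₂_lt_lam₁ hP hd
    intro h h'
    linarith
  refine ⟨?_, ?_, ?_, ⟨?_, hH.mono Set.inter_subset_right Set.inter_subset_right, ?_, ?_⟩, ?_,
    hH.mono Set.inter_subset_right Set.inter_subset_right, ?_, ?_⟩
  · rw [M_union_C₁_inter_H₁p hP h₁.le hd]
    exact isClosed_closedBall.inter isClosed_H₁p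
  · rw [M_union_C₂_inter_H₂m hP h₂.le hd]
    exact isClosed_closedBall.inter isClosed_H₂m
  · refine isOpen_M_inter (isClosed_H₁p.union isClosed_H₂m).isOpen_compl fun x hx => ?_
    rw [Set.mem_inter_iff, mem_M_iff hP hd.ne, Set.mem_compl_iff, Set.mem_union, mem_H₁p_iff,
      mem_H₂m_iff] at hx
    rw [mem_interior_M_iff hP hd.ne]
    have p₁ := gapAt_pos_iff₁ hP (x := x)
    have p₂ := gapAt_pos_iff₂ hP (x := x)
    generalize ‖x - P.x₁ m‖ = a, ‖x - P.x₂ m‖ = b, x 0 = t at *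
    grind
  · ext x
    rw [mem_frontier_M_iff hP hd, Set.mem_union, Set.mem_union, mem_T_iff hP,
      Set.mem_inter_iff, Set.mem_inter_iff, mem_frontier_B₁_iff hP, mem_frontier_B₂_iff hP,
      Set.mem_compl_iff, Set.mem_compl_iff, mem_H₁m_iff, mem_H₂p_iff]
    have p₁ := gapAt_pos_iff₁ hP (x := x)
    have p₂ := gapAt_pos_iff₂ hP (x := x)
    have k₁ := cap₁ hP hd (x := x)
    have k₂ := cap₂ hP hd (x := x)
    have c := center_facts hP x
    generalize ‖x - P.x₁ m‖ = a, ‖x - P.x₂ m‖ = b, x 0 = t at *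
    grind
  · rw [Set.disjoint_left]
    intro x
    rw [mem_T_iff hP, Set.mem_inter_iff, mem_frontier_B₁_iff hP, Set.mem_compl_iff, mem_H₁m_iff]
    have k₁ := cap₁ hP hd (x := x)
    generalize ‖x - P.x₁ m‖ = a, ‖x - P.x₂ m‖ = b, x 0 = t at *
    grind
  · rw [Set.disjoint_left]
    intro x
    rw [mem_T_iff hP, Set.mem_inter_iff, mem_frontier_B₂_iff hP, Set.mem_compl_iff, mem_H₂p_iff]
    have k₂ := cap₂ hP hd (x := x)
    generalize ‖x - P.x₁ m‖ = a, ‖x - P.x₂ m‖ = b, x 0 = t at *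
    grind
  · ext x
    rw [mem_interior_M_iff hP hd.ne, Set.mem_union, Set.mem_union, Set.mem_inter_iff,
      Set.mem_inter_iff, Set.mem_inter_iff, Set.mem_inter_iff, mem_T'_iff hP, Set.mem_compl_iff,
      Set.mem_compl_iff, mem_H₁m_iff, mem_H₂p_iff, mem_B₁_iff, mem_B₂_iff]
    have p₁ := gapAt_pos_iff₁ hP (x := x)
    have p₂ := gapAt_pos_iff₂ hP (x := x)
    have k₁ := cap₁ hP hd (x := x)
    have k₂ := cap₂ hP hd (x := x)
    generalize ‖x - P.x₁ m‖ = a, ‖x - P.x₂ m‖ = b, x 0 = t at *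
    grind
  · exact Set.disjoint_left.2 fun x hx hx' => hx.2 hx'.2.1
  · exact Set.disjoint_left.2 fun x hx hx' => hx.2 hx'.2.2

theorem two_mul_r_le (x : E m) (hP : P.Pos) :
    2 * P.r ≤ ‖x - P.x₁ m‖ + ‖x - P.x₂ m‖ := by
  rw [← norm_x₂_sub_x₁ (m := m) hP]
  have := norm_sub_le (x - P.x₁ m) (x - P.x₂ m)
  rwa [show x - P.x₁ m - (x - P.x₂ m) = P.x₂ m - P.x₁ m by abel] at this

theorem M_of_disjoint (hP : P.Pos) (hd : P.L / P.σ₁ + P.L / P.σ₂ < 2 * P.r) : P.M m = ∅ := by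
  ext x
  rw [mem_M_iff hP hd.ne']
  have := two_mul_r_le x hP
  constructor
  · rintro ⟨h1, h2, _⟩
    linarith
  · exact False.elim

/-- The triangle inequality is an equality, so both distances equal the radii; `a² - b²` then fixes
the first coordinate, and the tail vanishes. -/
theorem M_of_touching (hP : P.Pos) (hd : 2 * P.r = P.L / P.σ₁ + P.L / P.σ₂) :
    P.M m = {axisPoint m (P.L / 2 * (1 / P.σ₁ - 1 / P.σ₂))} := by
  have R₁ := hP.R₁_pos
  have R₂ := hP.R₂_pos
  have hr := hP.r_pos
  have ec : P.L / 2 * (1 / P.σ₁ - 1 / P.σ₂) = (P.L / P.σ₁ - P.L / P.σ₂) / 2 := by ring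
  rw [ec]
  ext x
  rw [Set.mem_singleton_iff]
  have tri := two_mul_r_le x hP
  have e := sq_sub_sq (P := P) x
  have nA := norm_sub_x₁_sq (P := P) x
  have hX : ‖x - P.x₁ m‖ = P.L / P.σ₁ → ‖x - P.x₂ m‖ = P.L / P.σ₂ →
      x = axisPoint m ((P.L / P.σ₁ - P.L / P.σ₂) / 2) := by
    intro ha hb
    have h0 : x 0 = (P.L / P.σ₁ - P.L / P.σ₂) / 2 := by
      rw [ha, hb] at e
      apply mul_left_cancel₀ (show 4 * P.r ≠ 0 by positivity)
      rw [← e, show 4 * P.r = 2 * (P.L / P.σ₁ + P.L / P.σ₂) by linarith]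
      ring
    refine eq_axisPoint_iff.2 ⟨h0, ?_⟩
    rw [← sq_eq_zero_iff]
    have : x 0 + P.r = P.L / P.σ₁ := by linarith
    rw [ha, this] at nA
    linarith
  constructor
  · rintro (h | h)
    · rw [← T', mem_T'_iff hP] at h
      have ha : ‖x - P.x₁ m‖ = P.L / P.σ₁ := by linarith [h.1, h.2.1]
      have hb : ‖x - P.x₂ m‖ = P.L / P.σ₂ := by linarith [h.1, h.2.1]
      exact hX ha hb
    · exact hX h.2.1 h.2.2
  · rintro rfl
    refine Or.inr ⟨?_, ?_, ?_⟩
    · rw [norm_x₂_sub_x₁ hP, hd]; ring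
    · rw [x₁, norm_axisPoint_sub, abs_of_pos] <;> linarith
    · rw [x₂, norm_axisPoint_sub, abs_of_neg] <;> linarith

end Params

end MinRegion

theorem mainTheorem3 (m : ℕ) (P : MinRegion.Params) (hσ₂ : 0 < P.σ₂) (hσ : P.σ₂ ≤ P.σ₁)
    (hL : 0 < P.L) (hr : 0 < P.r) :
    (P.r ≤ P.L / (2 * P.σ₁) →
      IsOpen (P.M m) ∧
      (frontier (P.M m) = P.T m ∪ {P.x₁ m, P.x₂ m} ∧ Disjoint (P.T m) {P.x₁ m, P.x₂ m}) ∧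
      interior (P.M m) = P.T' m) ∧
    (P.L / (2 * P.σ₁) < P.r → P.r ≤ P.L / (2 * P.σ₂) →
      IsClosed ((P.M m ∪ P.C₁ m) ∩ P.H₁p m) ∧
      IsOpen (P.M m ∩ (P.H₁p m)ᶜ) ∧
      (frontier (P.M m) = (frontier (P.B₁ m) ∩ (P.H₁m m)ᶜ) ∪ P.T m ∪ {P.x₁ m} ∧
        Disjoint (frontier (P.B₁ m) ∩ (P.H₁m m)ᶜ) (P.T m) ∧
        Disjoint (frontier (P.B₁ m) ∩ (P.H₁m m)ᶜ) {P.x₁ m} ∧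
        Disjoint (P.T m) {P.x₁ m}) ∧
      (interior (P.M m) = (P.B₁ m ∩ (P.H₁m m)ᶜ) ∪ (P.T' m ∩ P.H₁m m) ∧
        Disjoint (P.B₁ m ∩ (P.H₁m m)ᶜ) (P.T' m ∩ P.H₁m m))) ∧
    (P.L / (2 * P.σ₂) < P.r → P.r < P.L / 2 * (1 / P.σ₁ + 1 / P.σ₂) →
      IsClosed ((P.M m ∪ P.C₁ m) ∩ P.H₁p m) ∧
      IsClosed ((P.M m ∪ P.C₂ m) ∩ P.H₂m m) ∧
      IsOpen (P.M m ∩ (P.H₁p m ∪ P.H₂m m)ᶜ) ∧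
      (frontier (P.M m) =
          (frontier (P.B₁ m) ∩ (P.H₁m m)ᶜ) ∪ (frontier (P.B₂ m) ∩ (P.H₂p m)ᶜ) ∪ P.T m ∧
        Disjoint (frontier (P.B₁ m) ∩ (P.H₁m m)ᶜ) (frontier (P.B₂ m) ∩ (P.H₂p m)ᶜ) ∧
        Disjoint (frontier (P.B₁ m) ∩ (P.H₁m m)ᶜ) (P.T m) ∧
        Disjoint (frontier (P.B₂ m) ∩ (P.H₂p m)ᶜ) (P.T m)) ∧
      (interior (P.M m) =
          (P.B₁ m ∩ (P.H₁m m)ᶜ) ∪ (P.B₂ m ∩ (P.H₂p m)ᶜ) ∪ (P.T' m ∩ (P.H₁m m ∩ P.H₂p m)) ∧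
        Disjoint (P.B₁ m ∩ (P.H₁m m)ᶜ) (P.B₂ m ∩ (P.H₂p m)ᶜ) ∧
        Disjoint (P.B₁ m ∩ (P.H₁m m)ᶜ) (P.T' m ∩ (P.H₁m m ∩ P.H₂p m)) ∧
        Disjoint (P.B₂ m ∩ (P.H₂p m)ᶜ) (P.T' m ∩ (P.H₁m m ∩ P.H₂p m)))) ∧
    (P.r = P.L / 2 * (1 / P.σ₁ + 1 / P.σ₂) →
      P.M m = {MinRegion.axisPoint m (P.L / 2 * (1 / P.σ₁ - 1 / P.σ₂))}) ∧
    (P.L / 2 * (1 / P.σ₁ + 1 / P.σ₂) < P.r → P.M m = ∅) := by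
  have hP : P.Pos := ⟨hσ₂.trans_le hσ, hσ₂, hL, hr⟩
  have hσ₁ := hP.σ₁_pos
  -- The order of the radii reduces the smallest regime to `2r ≤ R₁` and gives `R₁ < 2r` in the
  -- regime `R₂ < 2r`.
  have hR : P.L / P.σ₁ ≤ P.L / P.σ₂ := by gcongr
  have e₁ : P.L / (2 * P.σ₁) = P.L / P.σ₁ / 2 := by field_simp
  have e₂ : P.L / (2 * P.σ₂) = P.L / P.σ₂ / 2 := by field_simp
  have e₃ : P.L / 2 * (1 / P.σ₁ + 1 / P.σ₂) = (P.L / P.σ₁ + P.L / P.σ₂) / 2 := by ring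
  rw [e₁, e₂, e₃]
  exact ⟨fun h => MinRegion.Params.M_of_small hP (by linarith) (by linarith),
    fun h h' => MinRegion.Params.M_of_medium hP (by linarith) (by linarith),
    fun h h' => MinRegion.Params.M_of_large hP (by linarith) (by linarith) (by linarith),
    fun h => MinRegion.Params.M_of_touching hP (by linarith),
    fun h => MinRegion.Params.M_of_disjoint hP (by linarith)⟩
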